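/- Let $N\ge 3$ and let $\mathbb V=\mathbb R^{n_1\times n_2\times\cdots\times n_N}$ carry the Frobenius norm $\|\cdot\|_F$. A function $g$ on a convex subset $C$ of a real Hilbert space is called $\mu$-weakly convex ($\mu\ge 0$) if $g+\frac{\mu}{2}\|\cdot\|^2$ is convex on $C$. Let $f:\mathbb R_{\ge 0}\to\mathbb R_{\ge 0}$ be $\mu$-weakly convex with $f(0)\le f(x)$ for all $x\ge 0$ (for instance $f(0)=0$, or $f$ nondecreasing), and such that for every $\eta>0$ the (possibly set-valued) proximal map $\operatorname{Prox}_{\eta f}(x)=\arg\min_{z\ge 0}\{f(z)+\frac1{2\eta}(z-x)^2\}$ is nondecreasing in $x\ge 0$ (that is, $p\le q$ whenever $x<y$, $p\in\operatorname{Prox}_{\eta f}(x)$, $q\in\operatorname{Prox}_{\eta f}(y)$). For $i=3,\dots,N$ let $\mathbf U_{n_i}=l_{n_i}\mathbf W_{n_i}$ with $l_{n_i}>0$ and $\mathbf W_{n_i}$ a complex unitary $n_i\times n_i$ matrix; put $\mathfrak L(\mathcal A)=\mathcal A\times_3\mathbf U_{n_3}\times_4\cdots\times_N\mathbf U_{n_N}$,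 where $\times_d$ is the tensor-matrix product along the $d$-th mode, $l=\prod_{i=3}^N l_{n_i}$ and $r=\min\{n_1,n_2\}$. Define $$\|\mathcal A\|_{f,\mathfrak L}=\frac1{l^2}\sum_{i_3,\dots,i_N}\sum_{j=1}^{r} f\Big(\sigma_j\big(\mathfrak L(\mathcal A)(:,:,i_3,\dots,i_N)\big)\Big),$$ where $\sigma_1\ge\dots\ge\sigma_r\ge 0$ are the singular values of an $n_1\times n_2$ matrix. For each mode $d$ let $\nabla_d\mathcal A=\mathcal A\times_d\mathbf D_{n_d}$, where $\mathbf D_{n_d}$ is the row circulant matrix of $(-1,1,0,\dots,0)$, i.e. $\nabla_d$ is the periodic forward difference along mode $d$ (which is $0$ if $n_d=1$). For a nonempty set $\Gamma\subseteq\{1,\dots,N\}$ of $\gamma$ elements put $$\|\mathcal A\|_{\mathrm{GTCTV}}=\frac1\gamma\sum_{d\in\Gamma}\|\nabla_d\mathcal A\|_{f,\mathfrak L}.$$ Then $\|\cdot\|_{\mathrm{GTCTV}}$ is $4\mu$-weakly convex on $\mathbb V$; that is, $\|\cdot\|_{\mathrm{GTCTV}}+2\mu\|\cdot\|_F^2$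 is convex on $\mathbb V$. -/

import Mathlib

noncomputable section

/-- Multi-indices of a tensor of size `n 0 × n 1 × ⋯`. -/
abbrev TensorIndex {N : ℕ} (n : Fin N → ℕ) : Type := (d : Fin N) → Fin (n d)

/-- The real Hilbert space of tensors of size `n 0 × n 1 × ⋯`, with the entrywise inner product,
so that the norm is the Frobenius norm. -/
abbrev TensorSpace {N : ℕ} (n : Fin N → ℕ) : Type := EuclideanSpace ℝ (TensorIndex n)

/-- `f` is `μ`-weakly convex on `s`: `μ ≥ 0` and `f + (μ/2) ‖·‖²` is convex on `s`
(that is, on the whole space when `f` is extended by `+∞` outside the convex set `s`). -/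
def WeaklyConvexOn {V : Type*} [NormedAddCommGroup V] [InnerProductSpace ℝ V]
    (μ : ℝ) (s : Set V) (f : V → ℝ) : Prop :=
  0 ≤ μ ∧ ConvexOn ℝ s (fun x => f x + μ / 2 * ‖x‖ ^ 2)

/-- The (possibly set-valued) proximal map `Prox_{η f}` of a function `f` on `[0, ∞)`:
the set of minimizers over `z ≥ 0` of `f z + (1 / (2 η)) (z - x)²`. -/
def proxSet (η : ℝ) (f : ℝ → ℝ) (x : ℝ) : Set ℝ :=
  {p | p ∈ Set.Ici (0 : ℝ) ∧
    IsMinOn (fun z => f z + 1 / (2 * η) * (z - x) ^ 2) (Set.Ici (0 : ℝ)) p}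

/-- The proximal map `Prox_{η f}` on `[0, ∞)` is nondecreasing, as a possibly set-valued map. -/
def ProxNondecreasing (η : ℝ) (f : ℝ → ℝ) : Prop :=
  ∀ ⦃x y : ℝ⦄, 0 ≤ x → x < y → ∀ p ∈ proxSet η f x, ∀ q ∈ proxSet η f y, p ≤ q

/-- The mode-`d` product `A ×_d F` of a tensor with a square matrix `F`, entrywise: in the `d`-th
index, the fibres of `A` are multiplied by `F`. -/
def modeProd {N : ℕ} {n : Fin N → ℕ} {R : Type*} [CommSemiring R] (d : Fin N)
    (F : Matrix (Fin (n d)) (Fin (n d)) R) (A : TensorIndex n → R) : TensorIndex n → R :=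
  fun i => ∑ j : Fin (n d), F (i d) j * A (Function.update i d j)

/-- The row circulant matrix of `(-1, 1, 0, …, 0)`: the `i`-th row has `-1` in position `i` and `1`
in position `i + 1` modulo `m`. (For `m = 1` the two positions coincide and the matrix is `0`.) -/
def diffMatrix (m : ℕ) : Matrix (Fin m) (Fin m) ℝ :=
  fun i j => (if j = finRotate m i then 1 else 0) - (if j = i then 1 else 0)

/-- The gradient operator along the `d`-th mode, `∇_d A = A ×_d D`. -/
def tensorGrad {N : ℕ} {n : Fin N → ℕ} (d : Fin N) (A : TensorIndex n → ℝ) : TensorIndex n → ℝ :=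
  modeProd d (diffMatrix (n d)) A

/-- `𝔏(A) = A ×₃ U₃ ×₄ ⋯ ×_N U_N`: the matrix `U k` acts on the mode with (zero-based) number
`k + 2`, that is, on all modes but the first two. -/
def tensorTransform {K : ℕ} {n : Fin (K + 2) → ℕ}
    (U : (k : Fin K) → Matrix (Fin (n k.succ.succ)) (Fin (n k.succ.succ)) ℂ)
    (A : TensorIndex n → ℂ) : TensorIndex n → ℂ :=
  (List.finRange K).foldl (fun B k => modeProd k.succ.succ (U k) B) A

/-- The face slice `A(:, :, i₃, …, i_N)`. -/
def faceSlice {K : ℕ} {n : Fin (K + 2) → ℕ} {R : Type*} (A : TensorIndex n → R)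
    (i : (k : Fin K) → Fin (n k.succ.succ)) : Matrix (Fin (n 0)) (Fin (n 1)) R :=
  fun a b => A (Fin.cons (α := fun d => Fin (n d)) a
    (Fin.cons (α := fun d : Fin (K + 1) => Fin (n d.succ)) b i))

/-- `σ_j(M)`: the singular values of a complex matrix in nonincreasing order, counted from
`j = 0`. -/
def matrixSingularValue {p q : ℕ} (M : Matrix (Fin p) (Fin q) ℂ) (j : ℕ) : ℝ :=
  (Matrix.toEuclideanLin M).singularValues j

/-- The tensor `f`-penalty
`‖A‖_{f,𝔏} = (1 / l²) ∑_{i₃ … i_N} ∑_{j=1}^{r} f (σ_j (𝔏(A)^{(i₃ … i_N)}))`, where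
`r = min n₁ n₂` and `l = ∏ l_k`. -/
def tensorPenalty {K : ℕ} {n : Fin (K + 2) → ℕ} (f : ℝ → ℝ)
    (U : (k : Fin K) → Matrix (Fin (n k.succ.succ)) (Fin (n k.succ.succ)) ℂ) (l : Fin K → ℝ)
    (A : TensorIndex n → ℝ) : ℝ :=
  1 / (∏ k, l k) ^ 2 *
    ∑ i : (k : Fin K) → Fin (n k.succ.succ), ∑ j ∈ Finset.range (min (n 0) (n 1)),
      f (matrixSingularValue (faceSlice (tensorTransform U (fun t => (A t : ℂ))) i) j)

/-- The generalized tensor correlated total variation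
`‖A‖_GTCTV = (1 / γ) ∑_{d ∈ Γ} ‖∇_d A‖_{f,𝔏}`, where `γ` is the cardinality of `Γ`. -/
def gtctv {K : ℕ} {n : Fin (K + 2) → ℕ} (f : ℝ → ℝ)
    (U : (k : Fin K) → Matrix (Fin (n k.succ.succ)) (Fin (n k.succ.succ)) ℂ) (l : Fin K → ℝ)
    (Γ : Finset (Fin (K + 2))) (A : TensorSpace n) : ℝ :=
  1 / (Γ.card : ℝ) * ∑ d ∈ Γ, tensorPenalty f U l (tensorGrad d (fun t => A t))

end

/-! Put `g x = f x + (μ/2) x²`, which is convex on `[0, ∞)` and least at `0`, hence nondecreasing.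
For such `g`, `∑ g (σ_k T)` is convex in `T`: it dominates `∑ g (max 0 (Re ⟪u_j, T v_j⟫))` for all
sub-orthonormal `u`, `v` (`ConvexOn.sum_comp_max_re_inner_le`), with equality at the singular
vectors of `T`. As `∑ σ_k²` is the squared Frobenius norm, a spectral sum of `f` becomes convex
after adding `μ/2` times that norm squared (`convexOn_spectral_sum_add`). Summing over the slices of
`𝔏 (∇_d A)`, the penalty plus `(μ/2) l⁻² ‖𝔏 (∇_d A)‖²` is convex. Each `U k` scales norms by `l k`
and `‖∇_d A‖² ≤ 4 ‖A‖²`, so `4 ‖A‖² - l⁻² ‖𝔏 (∇_d A)‖²` is a nonnegative quadratic form, hence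
convex. Adding `μ/2` times it leaves `2 μ ‖A‖²`, and averaging over `Γ` preserves convexity. -/

open scoped InnerProductSpace

/-- Pairwise orthogonal vectors of norm at most one. -/
def SubOrthonormal {ι F : Type*} [NormedAddCommGroup F] [InnerProductSpace ℂ F] (u : ι → F) :
    Prop :=
  (∀ j, ‖u j‖ ≤ 1) ∧ Pairwise fun i j => ⟪u i, u j⟫_ℂ = 0

/-- Bessel's inequality: zero vectors contribute nothing, and normalising the others only enlarges
the inner products. -/
theorem SubOrthonormal.sum_norm_inner_sq_le {ι F : Type*} [Fintype ι] [NormedAddCommGroup F]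
    [InnerProductSpace ℂ F] {u : ι → F} (hu : SubOrthonormal u) (x : F) :
    ∑ j, ‖⟪u j, x⟫_ℂ‖ ^ 2 ≤ ‖x‖ ^ 2 := by
  classical
  let v : {j // u j ≠ 0} → F := fun j => ((‖u j‖⁻¹ : ℝ) : ℂ) • u j
  have hv : Orthonormal ℂ v := by
    constructor
    · intro j
      simp [v, norm_smul, j.2]
    · intro i j hij
      simp [v, inner_smul_left, inner_smul_right, hu.2 (Subtype.coe_injective.ne hij)]
  calc ∑ j, ‖⟪u j, x⟫_ℂ‖ ^ 2 = ∑ j with u j ≠ 0, ‖⟪u j, x⟫_ℂ‖ ^ 2 := by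
        rw [Finset.sum_filter]
        refine Finset.sum_congr rfl fun j _ => ?_
        by_cases h : u j = 0 <;> simp [h]
    _ = ∑ j : {j // u j ≠ 0}, ‖⟪u j, x⟫_ℂ‖ ^ 2 := by
        rw [← Finset.sum_subtype_eq_sum_filter]; simp
    _ ≤ ∑ j, ‖⟪v j, x⟫_ℂ‖ ^ 2 := by
        refine Finset.sum_le_sum fun j _ => ?_
        have h0 : 0 < ‖u j‖ := norm_pos_iff.2 j.2
        have : 1 ≤ ‖u j‖⁻¹ := (one_le_inv₀ h0).2 (hu.1 j)
        simp only [v, inner_smul_left, norm_mul, Complex.conj_ofReal, Complex.norm_real, norm_inv,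
          norm_norm]
        gcongr
        exact le_mul_of_one_le_left (norm_nonneg _) this
    _ ≤ ‖x‖ ^ 2 := hv.sum_inner_products_le (s := Finset.univ) x

theorem Orthonormal.subOrthonormal {ι F : Type*} [NormedAddCommGroup F] [InnerProductSpace ℂ F]
    {u : ι → F} (hu : Orthonormal ℂ u) : SubOrthonormal u :=
  ⟨fun j => (hu.1 j).le, hu.2⟩

/-! ### Singular values and convexity of spectral sums -/

section SingularValues

variable {E F : Type*} [NormedAddCommGroup E] [InnerProductSpace ℂ E] [FiniteDimensional ℂ E]
  [NormedAddCommGroup F] [InnerProductSpace ℂ F] [FiniteDimensional ℂ F] {q : ℕ}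

/-- Here `y` is an eigenbasis of `T* T` and `x k = σ_k⁻¹ T (y k)`. Where `σ_k = 0` this vector is
`0`; allowing that permits all `q` indices even when `q` exceeds `dim F`. -/
theorem LinearMap.exists_singularValue_decomposition (hq : Module.finrank ℂ E = q)
    (T : E →ₗ[ℂ] F) :
    ∃ (y : OrthonormalBasis (Fin q) ℂ E) (x : Fin q → F), SubOrthonormal x ∧
      (∀ k : Fin q, T (y k) = (T.singularValues k : ℂ) • x k) ∧
      (∀ k : Fin q, ⟪x k, T (y k)⟫_ℂ = T.singularValues k) ∧
      ∀ k : Fin q, ‖T (y k)‖ ^ 2 = T.singularValues k ^ 2 := by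
  let y := T.isSymmetric_adjoint_comp_self.eigenvectorBasis hq
  have hin : ∀ i j, ⟪T (y i), T (y j)⟫_ℂ = if i = j then (T.singularValues j : ℂ) ^ 2 else 0 := by
    intro i j
    have h := T.isSymmetric_adjoint_comp_self.apply_eigenvectorBasis hq j
    rw [← LinearMap.adjoint_inner_right]
    rw [LinearMap.comp_apply] at h
    rw [h, inner_smul_right, OrthonormalBasis.inner_eq_ite, ← T.sq_singularValues_fin hq j]
    split_ifs <;> simp
  have hsq : ∀ k : Fin q, ‖T (y k)‖ ^ 2 = T.singularValues k ^ 2 := by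
    intro k
    have h := hin k k
    rw [if_pos rfl, inner_self_eq_norm_sq_to_K] at h
    apply Complex.ofReal_injective
    push_cast
    exact h
  have hnorm : ∀ k : Fin q, ‖T (y k)‖ = T.singularValues k := fun k =>
    (sq_eq_sq₀ (norm_nonneg _) (T.singularValues_nonneg k)).1 (hsq k)
  refine ⟨y, fun k => ((T.singularValues k)⁻¹ : ℂ) • T (y k), ⟨?_, ?_⟩, ?_, ?_, hsq⟩
  · intro k
    rw [norm_smul, hnorm, norm_inv, Complex.norm_real, Real.norm_of_nonneg (T.singularValues_nonneg k)]
    exact inv_mul_le_one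
  · intro i j hij
    simp [hin, hij]
  · intro k
    by_cases h : T.singularValues k = 0
    · have : T (y k) = 0 := by rw [← norm_eq_zero, hnorm, h]
      simp [this]
    · rw [smul_smul, mul_inv_cancel₀ (by exact_mod_cast h), one_smul]
  · intro k
    by_cases h : T.singularValues k = 0
    · simp [h]
    · have h' : (T.singularValues k : ℂ) ≠ 0 := by exact_mod_cast h
      simp only [inner_smul_left, hin, map_inv₀, Complex.conj_ofReal, if_true]
      field_simp

/-- The numbers `Re ⟪u_j, T v_j⟫` are dominated by a doubly substochastic matrix applied to the
singular values, so Jensen applies row by row. Truncation at `0` keeps the arguments in the domain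
of `g`. -/
theorem ConvexOn.sum_comp_max_re_inner_le {g : ℝ → ℝ} (hg : ConvexOn ℝ (Set.Ici 0) g)
    (hmono : MonotoneOn g (Set.Ici 0)) (hq : Module.finrank ℂ E = q) (T : E →ₗ[ℂ] F)
    {u : Fin q → F} {v : Fin q → E} (hu : SubOrthonormal u) (hv : SubOrthonormal v) :
    ∑ j, g (max 0 (⟪u j, T (v j)⟫_ℂ).re) ≤ ∑ k : Fin q, g (T.singularValues k) := by
  obtain ⟨y, x, hx, hT, -, -⟩ := T.exists_singularValue_decomposition hq
  set s : Fin q → ℝ := fun k => T.singularValues k with hs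
  have hs0 : ∀ k, 0 ≤ s k := fun k => T.singularValues_nonneg k
  -- By AM-GM, `P j k` bounds the modulus of the coefficient of `σ_k` in `⟪u_j, T v_j⟫`; Bessel
  -- bounds its row and column sums by one.
  let P : Fin q → Fin q → ℝ := fun j k => (‖⟪u j, x k⟫_ℂ‖ ^ 2 + ‖⟪y k, v j⟫_ℂ‖ ^ 2) / 2
  have hP0 : ∀ j k, 0 ≤ P j k := fun j k => by positivity
  have hrow : ∀ j, ∑ k, P j k ≤ 1 := by
    intro j
    have h1 := hx.sum_norm_inner_sq_le (u j)
    have h2 := y.orthonormal.subOrthonormal.sum_norm_inner_sq_le (v j)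
    have h3 := pow_le_one₀ (n := 2) (norm_nonneg _) (hu.1 j)
    have h4 := pow_le_one₀ (n := 2) (norm_nonneg _) (hv.1 j)
    simp_rw [norm_inner_symm (x _)] at h1
    rw [← Finset.sum_div, Finset.sum_add_distrib]
    linarith
  have hcol : ∀ k, ∑ j, P j k ≤ 1 := by
    intro k
    have h1 := hu.sum_norm_inner_sq_le (x k)
    have h2 := hv.sum_norm_inner_sq_le (y k)
    have h3 := pow_le_one₀ (n := 2) (norm_nonneg _) (hx.1 k)
    have h4 : ‖y k‖ = 1 := y.orthonormal.1 k
    simp_rw [norm_inner_symm (v _)] at h2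
    rw [h4] at h2
    rw [← Finset.sum_div, Finset.sum_add_distrib]
    linarith
  have hbound : ∀ j, max 0 (⟪u j, T (v j)⟫_ℂ).re ≤ ∑ k, P j k * s k := by
    intro j
    refine max_le (Finset.sum_nonneg fun k _ => mul_nonneg (hP0 j k) (hs0 k)) ?_
    have : T (v j) = ∑ k, (⟪y k, v j⟫_ℂ * s k) • x k := by
      conv_lhs => rw [← y.sum_repr' (v j)]
      rw [map_sum]
      exact Finset.sum_congr rfl fun k _ => by rw [map_smul, hT, smul_smul]
    rw [this, inner_sum, Complex.re_sum]
    refine Finset.sum_le_sum fun k _ => (Complex.re_le_norm _).trans ?_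
    rw [inner_smul_right, norm_mul, norm_mul, Complex.norm_real, Real.norm_of_nonneg (hs0 k)]
    have := two_mul_le_add_sq ‖⟪u j, x k⟫_ℂ‖ ‖⟪y k, v j⟫_ℂ‖
    have := mul_le_mul_of_nonneg_right this (hs0 k)
    simp only [P]
    linarith
  have hterm : ∀ j, g (max 0 (⟪u j, T (v j)⟫_ℂ).re) ≤ g 0 + ∑ k, P j k * (g (s k) - g 0) := by
    intro j
    have hS : 0 ≤ ∑ k, P j k * s k := Finset.sum_nonneg fun k _ => mul_nonneg (hP0 j k) (hs0 k)
    refine (hmono (Set.mem_Ici.2 (le_max_left _ _)) hS (hbound j)).trans ?_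
    -- The row weights may sum to less than one; the extra index `none` puts the missing mass at the
    -- point `0`.
    have h := hg.map_sum_le (t := Finset.univ)
      (w := fun o : Option (Fin q) => o.elim (1 - ∑ k, P j k) (P j))
      (p := fun o : Option (Fin q) => o.elim 0 s) ?_ ?_ ?_
    · simp only [Fintype.sum_option, Option.elim, smul_eq_mul, mul_zero, zero_add] at h
      refine h.trans (le_of_eq ?_)
      simp_rw [mul_sub]
      rw [Finset.sum_sub_distrib, ← Finset.sum_mul]
      ring
    · rintro (_ | k) _
      · exact sub_nonneg.2 (hrow j)
      · exact hP0 j k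
    · simp [Fintype.sum_option]
    · rintro (_ | k) _
      · simp
      · exact hs0 k
  calc ∑ j, g (max 0 (⟪u j, T (v j)⟫_ℂ).re)
      ≤ ∑ j, (g 0 + ∑ k, P j k * (g (s k) - g 0)) := Finset.sum_le_sum fun j _ => hterm j
    _ = ∑ k : Fin q, (g 0 + (∑ j, P j k) * (g (s k) - g 0)) := by
        rw [Finset.sum_add_distrib, Finset.sum_add_distrib, Finset.sum_comm]
        simp_rw [Finset.sum_mul]
    _ ≤ ∑ k, g (s k) := by
        refine Finset.sum_le_sum fun k _ => ?_
        have h1 : 0 ≤ g (s k) - g 0 :=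
          sub_nonneg.2 (hmono (Set.mem_Ici.2 le_rfl) (hs0 k) (hs0 k))
        have := mul_le_of_le_one_left h1 (hcol k)
        linarith

/-- With the singular vectors of the combination fixed, its singular values are linear in `S` and
`T`; the preceding bound then treats `S` and `T` separately. -/
theorem ConvexOn.sum_singularValues_le {g : ℝ → ℝ} (hg : ConvexOn ℝ (Set.Ici 0) g)
    (hmono : MonotoneOn g (Set.Ici 0)) (hq : Module.finrank ℂ E = q) (S T : E →ₗ[ℂ] F)
    {a b : ℝ} (ha : 0 ≤ a) (hb : 0 ≤ b) (hab : a + b = 1) :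
    ∑ k : Fin q, g (((a : ℂ) • S + (b : ℂ) • T).singularValues k) ≤
      a * ∑ k : Fin q, g (S.singularValues k) + b * ∑ k : Fin q, g (T.singularValues k) := by
  set R := (a : ℂ) • S + (b : ℂ) • T with hR
  obtain ⟨v, u, hu, -, huv, -⟩ := R.exists_singularValue_decomposition hq
  have hv := v.orthonormal.subOrthonormal
  have hterm : ∀ k : Fin q, g (R.singularValues k) ≤
      a * g (max 0 (⟪u k, S (v k)⟫_ℂ).re) + b * g (max 0 (⟪u k, T (v k)⟫_ℂ).re) := by
    intro k
    have h1 : R.singularValues k =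
        a * (⟪u k, S (v k)⟫_ℂ).re + b * (⟪u k, T (v k)⟫_ℂ).re := by
      have := congrArg Complex.re (huv k)
      rw [Complex.ofReal_re] at this
      rw [← this, hR]
      simp
    have hmem : ∀ z : ℝ, max 0 z ∈ Set.Ici (0 : ℝ) := fun z => Set.mem_Ici.2 (le_max_left _ _)
    refine le_trans (hmono (R.singularValues_nonneg k) ?_ ?_)
      (hg.2 (hmem (⟪u k, S (v k)⟫_ℂ).re) (hmem (⟪u k, T (v k)⟫_ℂ).re) ha hb hab)
    · exact hg.1 (hmem _) (hmem _) ha hb hab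
    · rw [h1, smul_eq_mul, smul_eq_mul]
      gcongr <;> exact le_max_right _ _
  refine (Finset.sum_le_sum fun k _ => hterm k).trans ?_
  rw [Finset.sum_add_distrib, ← Finset.mul_sum, ← Finset.mul_sum]
  exact add_le_add
    (mul_le_mul_of_nonneg_left (hg.sum_comp_max_re_inner_le hmono hq S hu hv) ha)
    (mul_le_mul_of_nonneg_left (hg.sum_comp_max_re_inner_le hmono hq T hu hv) hb)

theorem LinearMap.sum_norm_sq_orthonormalBasis_eq {ι κ : Type*} [Fintype ι] [Fintype κ]
    (T : E →ₗ[ℂ] F) (y : OrthonormalBasis ι ℂ E) (e : OrthonormalBasis κ ℂ F) :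
    ∑ k, ‖T (y k)‖ ^ 2 = ∑ a, ‖LinearMap.adjoint T (e a)‖ ^ 2 := by
  simp_rw [← e.sum_sq_norm_inner_right (T _), ← y.sum_sq_norm_inner_right (LinearMap.adjoint T _)]
  rw [Finset.sum_comm]
  simp_rw [LinearMap.adjoint_inner_right, norm_inner_symm]

theorem LinearMap.sum_sq_singularValues_eq {ι : Type*} [Fintype ι]
    (hq : Module.finrank ℂ E = q) (T : E →ₗ[ℂ] F) (y : OrthonormalBasis ι ℂ E) :
    ∑ k : Fin q, T.singularValues k ^ 2 = ∑ k, ‖T (y k)‖ ^ 2 := by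
  obtain ⟨z, -, -, -, -, hz⟩ := T.exists_singularValue_decomposition hq
  simp_rw [← hz]
  rw [T.sum_norm_sq_orthonormalBasis_eq z (stdOrthonormalBasis ℂ F),
    T.sum_norm_sq_orthonormalBasis_eq y (stdOrthonormalBasis ℂ F)]

end SingularValues

/-! ### Spectral sums of matrices -/

theorem sum_sq_matrixSingularValue {p q : ℕ} (M : Matrix (Fin p) (Fin q) ℂ) :
    ∑ j : Fin q, matrixSingularValue M j ^ 2 = ∑ i, ∑ j, ‖M i j‖ ^ 2 := by
  simp only [matrixSingularValue]
  rw [LinearMap.sum_sq_singularValues_eq (by simp) _ (EuclideanSpace.basisFun (Fin q) ℂ),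
    Finset.sum_comm]
  refine Finset.sum_congr rfl fun k _ => ?_
  rw [EuclideanSpace.norm_sq_eq]
  simp [Matrix.toLpLin_apply]

theorem matrixSingularValue_eq_zero {p q : ℕ} (M : Matrix (Fin p) (Fin q) ℂ) {j : ℕ}
    (hj : p ≤ j) : matrixSingularValue M j = 0 := by
  rw [matrixSingularValue, LinearMap.singularValues_eq_zero_iff_le_finrank_range]
  exact (Submodule.finrank_le _).trans (by simpa using hj)

/-- Padding the sum to `q` terms adds only copies of `f 0`, a constant that does not affect
convexity. -/
theorem sum_range_min_matrixSingularValue {p q : ℕ} (f : ℝ → ℝ) (M : Matrix (Fin p) (Fin q) ℂ) :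
    ∑ j ∈ Finset.range (min p q), f (matrixSingularValue M j) =
      ∑ j : Fin q, f (matrixSingularValue M j) - (q - min p q : ℕ) * f 0 := by
  rw [Fin.sum_univ_eq_sum_range (fun j => f (matrixSingularValue M j)) q,
    ← Finset.sum_range_add_sum_Ico _ (min_le_right p q), eq_sub_iff_add_eq, add_right_inj,
    Finset.sum_congr rfl (g := fun _ => f 0)]
  · simp
  · intro j hj
    rw [Finset.mem_Ico] at hj
    rw [matrixSingularValue_eq_zero]
    omega

/-- The spectral sum of a `μ`-weakly convex function which is minimal at `0` is `μ`-weakly convex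
for the Frobenius norm. -/
theorem convexOn_spectral_sum_add {p q : ℕ} {f : ℝ → ℝ} {μ : ℝ} (hμ : 0 ≤ μ)
    (hf_min : ∀ x, 0 ≤ x → f 0 ≤ f x)
    (hf : ConvexOn ℝ (Set.Ici (0 : ℝ)) fun x => f x + μ / 2 * ‖x‖ ^ 2) :
    ConvexOn ℝ Set.univ fun M : Matrix (Fin p) (Fin q) ℂ =>
      ∑ j ∈ Finset.range (min p q), f (matrixSingularValue M j) +
        μ / 2 * ∑ i, ∑ j, ‖M i j‖ ^ 2 := by
  set g : ℝ → ℝ := fun x => f x + μ / 2 * ‖x‖ ^ 2 with hg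
  have hg0 : ∀ x, 0 ≤ x → g 0 ≤ g x := by
    intro x hx
    have := hf_min x hx
    have : 0 ≤ μ / 2 * ‖x‖ ^ 2 := by positivity
    simp only [hg, norm_zero]
    linarith
  -- For `0 ≤ x < y`, `x` is a convex combination of `0` and `y`, and `g 0 ≤ g y`.
  have hmono : MonotoneOn g (Set.Ici 0) := by
    intro x hx y hy hxy
    rcases hxy.eq_or_lt with rfl | hlt
    · exact le_rfl
    have hy0 : 0 < y := lt_of_le_of_lt hx hlt
    have hxy' : 0 ≤ 1 - x / y := sub_nonneg.2 ((div_le_one hy0).2 hxy)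
    have h := hf.2 (Set.mem_Ici.2 le_rfl) hy hxy' (div_nonneg hx hy0.le) (by ring)
    simp only [smul_eq_mul, mul_zero, zero_add, div_mul_cancel₀ _ hy0.ne'] at h
    have h2 : (1 - x / y) * g 0 ≤ (1 - x / y) * g y :=
      mul_le_mul_of_nonneg_left (hg0 y hy) hxy'
    linarith
  have hform : ∀ M : Matrix (Fin p) (Fin q) ℂ,
      ∑ j ∈ Finset.range (min p q), f (matrixSingularValue M j) +
        μ / 2 * ∑ i, ∑ j, ‖M i j‖ ^ 2 =
      ∑ j : Fin q, g (matrixSingularValue M j) - (q - min p q : ℕ) * f 0 := by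
    intro M
    rw [sum_range_min_matrixSingularValue, ← sum_sq_matrixSingularValue]
    simp only [hg, Finset.sum_add_distrib, ← Finset.mul_sum, Real.norm_eq_abs, sq_abs]
    ring
  refine ⟨convex_univ, fun A _ B _ a b ha hb hab => ?_⟩
  simp only [hform, smul_eq_mul]
  have key := hf.sum_singularValues_le hmono (q := q) (by simp) (Matrix.toEuclideanLin A)
    (Matrix.toEuclideanLin B) ha hb hab
  have hAB : Matrix.toEuclideanLin (a • A + b • B) =
      (a : ℂ) • Matrix.toEuclideanLin A + (b : ℂ) • Matrix.toEuclideanLin B := by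
    rw [← map_smul, ← map_smul, ← map_add]
    rfl
  rw [← hAB] at key
  simp only [matrixSingularValue]
  generalize ((q - min p q : ℕ) : ℝ) * f 0 = c
  have hb' : b = 1 - a := by linarith
  subst hb'
  linarith

/-! ### Norm bounds for mode products and the transform -/

/-- Exchanging `j` with the `d`-th entry of `i` is an involution on pairs. This allows summation
over mode-`d` fibres without splitting the index type. -/
theorem card_mul_sum_eq_sum_sum_update {N : ℕ} {n : Fin N → ℕ} (d : Fin N)
    (φ : TensorIndex n → ℝ) :
    (n d : ℝ) * ∑ i, φ i = ∑ i, ∑ j : Fin (n d), φ (Function.update i d j) := by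
  let e : TensorIndex n × Fin (n d) → TensorIndex n × Fin (n d) :=
    fun x => (Function.update x.1 d x.2, x.1 d)
  have he : Function.Involutive e := fun x => by simp [e]
  have h := Equiv.sum_comp he.toPerm fun x : TensorIndex n × Fin (n d) => φ x.1
  rw [Fintype.sum_prod_type, Fintype.sum_prod_type] at h
  refine Eq.trans ?_ h.symm
  simp [Finset.mul_sum]

theorem sum_norm_sq_modeProd_le {N : ℕ} {n : Fin N → ℕ} {R : Type*} [NormedCommRing R]
    (d : Fin N) (F : Matrix (Fin (n d)) (Fin (n d)) R) {c : ℝ}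
    (hF : ∀ a : Fin (n d) → R, ∑ j, ‖(F.mulVec a) j‖ ^ 2 ≤ c * ∑ j, ‖a j‖ ^ 2)
    (A : TensorIndex n → R) :
    ∑ i, ‖modeProd d F A i‖ ^ 2 ≤ c * ∑ i, ‖A i‖ ^ 2 := by
  rcases Nat.eq_zero_or_pos (n d) with h0 | hpos
  · have : IsEmpty (TensorIndex n) := ⟨fun i => (Fin.cast h0 (i d)).elim0⟩
    simp
  · have hpos' : (0 : ℝ) < n d := by exact_mod_cast hpos
    refine le_of_mul_le_mul_left ?_ hpos'
    rw [mul_left_comm, card_mul_sum_eq_sum_sum_update, card_mul_sum_eq_sum_sum_update,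
      Finset.mul_sum]
    refine Finset.sum_le_sum fun i _ => ?_
    refine le_trans (le_of_eq ?_) (hF fun j => A (Function.update i d j))
    simp [modeProd, Matrix.mulVec, dotProduct]

theorem modeProd_smul_add_smul {N : ℕ} {n : Fin N → ℕ} {R : Type*} [CommSemiring R] (d : Fin N)
    (F : Matrix (Fin (n d)) (Fin (n d)) R) (a b : R) (A B : TensorIndex n → R) :
    modeProd d F (a • A + b • B) = a • modeProd d F A + b • modeProd d F B := by
  ext i
  simp only [modeProd, Pi.add_apply, Pi.smul_apply, smul_eq_mul, Finset.mul_sum,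
    ← Finset.sum_add_distrib]
  exact Finset.sum_congr rfl fun j _ => by ring

/-- From `(x - y)² ≤ 2 x² + 2 y²`; the cyclic shift permutes the entries, so both halves have the
same sum. -/
theorem sum_norm_sq_diffMatrix_mulVec_le (m : ℕ) (a : Fin m → ℝ) :
    ∑ j, ‖((diffMatrix m).mulVec a) j‖ ^ 2 ≤ 4 * ∑ j, ‖a j‖ ^ 2 := by
  have h : ∀ j, ((diffMatrix m).mulVec a) j = a (finRotate m j) - a j := fun j => by
    simp [Matrix.mulVec, dotProduct, diffMatrix, sub_mul, Finset.sum_sub_distrib]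
  have hle : ∀ j, ‖((diffMatrix m).mulVec a) j‖ ^ 2 ≤
      2 * ‖a (finRotate m j)‖ ^ 2 + 2 * ‖a j‖ ^ 2 := fun j => by
    simp only [h, Real.norm_eq_abs, sq_abs]
    nlinarith [sq_nonneg (a (finRotate m j) + a j)]
  refine (Finset.sum_le_sum fun j _ => hle j).trans (le_of_eq ?_)
  rw [Finset.sum_add_distrib, ← Finset.mul_sum, ← Finset.mul_sum,
    Equiv.sum_comp (finRotate m) fun j => ‖a j‖ ^ 2]
  ring

theorem sum_norm_sq_unitary_mulVec {m : ℕ} {W : Matrix (Fin m) (Fin m) ℂ}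
    (hW : W ∈ Matrix.unitaryGroup (Fin m) ℂ) (a : Fin m → ℂ) :
    ∑ j, ‖(W.mulVec a) j‖ ^ 2 = ∑ j, ‖a j‖ ^ 2 := by
  have h : ∀ v : Fin m → ℂ, ((∑ j, ‖v j‖ ^ 2 : ℝ) : ℂ) = dotProduct (star v) v := fun v => by
    simp [dotProduct, Complex.conj_mul']
  apply Complex.ofReal_injective
  rw [h, h, Matrix.star_mulVec, Matrix.dotProduct_mulVec, Matrix.vecMul_vecMul,
    ← Matrix.star_eq_conjTranspose, Matrix.mem_unitaryGroup_iff'.1 hW, Matrix.vecMul_one]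

theorem tensorTransform_smul_add_smul {K : ℕ} {n : Fin (K + 2) → ℕ}
    (U : (k : Fin K) → Matrix (Fin (n k.succ.succ)) (Fin (n k.succ.succ)) ℂ)
    (a b : ℂ) (A B : TensorIndex n → ℂ) :
    tensorTransform U (a • A + b • B) = a • tensorTransform U A + b • tensorTransform U B := by
  unfold tensorTransform
  induction List.finRange K generalizing A B with
  | nil => rfl
  | cons k L ih => simp only [List.foldl_cons, modeProd_smul_add_smul, ih]

theorem sum_norm_sq_tensorTransform_le {K : ℕ} {n : Fin (K + 2) → ℕ}
    (U : (k : Fin K) → Matrix (Fin (n k.succ.succ)) (Fin (n k.succ.succ)) ℂ) (l : Fin K → ℝ)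
    (hU : ∀ k, ∃ W : Matrix (Fin (n k.succ.succ)) (Fin (n k.succ.succ)) ℂ,
      W ∈ Matrix.unitaryGroup (Fin (n k.succ.succ)) ℂ ∧ U k = (l k : ℂ) • W)
    (A : TensorIndex n → ℂ) :
    ∑ i, ‖tensorTransform U A i‖ ^ 2 ≤ (∏ k, l k) ^ 2 * ∑ i, ‖A i‖ ^ 2 := by
  have hstep : ∀ (k : Fin K) (B : TensorIndex n → ℂ),
      ∑ i, ‖modeProd k.succ.succ (U k) B i‖ ^ 2 ≤ l k ^ 2 * ∑ i, ‖B i‖ ^ 2 := by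
    intro k B
    obtain ⟨W, hW, hUW⟩ := hU k
    refine sum_norm_sq_modeProd_le _ _ (fun a => le_of_eq ?_) B
    rw [hUW, ← sum_norm_sq_unitary_mulVec hW a, Finset.mul_sum]
    simp [Matrix.smul_mulVec, mul_pow]
  rw [Fin.prod_univ_def]
  unfold tensorTransform
  induction List.finRange K generalizing A with
  | nil => simp
  | cons k L ih =>
    rw [List.foldl_cons, List.map_cons, List.prod_cons]
    refine (ih _).trans ?_
    rw [mul_pow, mul_comm (l k ^ 2), mul_assoc]
    exact mul_le_mul_of_nonneg_left (hstep k A) (sq_nonneg _)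

theorem sum_faceSlice {K : ℕ} {n : Fin (K + 2) → ℕ} {R : Type*} (φ : R → ℝ)
    (A : TensorIndex n → R) :
    ∑ i, ∑ a, ∑ b, φ (faceSlice A i a b) = ∑ t, φ (A t) := by
  rw [← Equiv.sum_comp (Fin.consEquiv fun d => Fin (n d)), Fintype.sum_prod_type, Finset.sum_comm]
  refine Finset.sum_congr rfl fun a _ => ?_
  rw [← Equiv.sum_comp (Fin.consEquiv fun d : Fin (K + 1) => Fin (n d.succ)),
    Fintype.sum_prod_type, Finset.sum_comm]
  rfl

/-! ### The transformed gradient and the convexity of the total variation -/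

/-- The transformed gradient `𝔏(∇_d A)`. -/
def transformedGrad {K : ℕ} {n : Fin (K + 2) → ℕ}
    (U : (k : Fin K) → Matrix (Fin (n k.succ.succ)) (Fin (n k.succ.succ)) ℂ) (d : Fin (K + 2))
    (A : TensorSpace n) : TensorIndex n → ℂ :=
  tensorTransform U fun t => (tensorGrad d (fun s => A s) t : ℂ)

section TransformedGrad

variable {K : ℕ} {n : Fin (K + 2) → ℕ}
  (U : (k : Fin K) → Matrix (Fin (n k.succ.succ)) (Fin (n k.succ.succ)) ℂ) (d : Fin (K + 2))

theorem transformedGrad_smul_add_smul (a b : ℝ) (A B : TensorSpace n) :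
    transformedGrad U d (a • A + b • B) =
      (a : ℂ) • transformedGrad U d A + (b : ℂ) • transformedGrad U d B := by
  unfold transformedGrad
  rw [← tensorTransform_smul_add_smul]
  congr 1
  ext t
  have h := congrFun (modeProd_smul_add_smul d (diffMatrix (n d)) a b (fun s => A s)
    (fun s => B s)) t
  change ((modeProd d (diffMatrix (n d)) (a • (fun s => A s) + b • (fun s => B s)) t : ℝ) : ℂ) = _
  rw [h]
  simp [tensorGrad]

theorem sum_norm_sq_transformedGrad_le (l : Fin K → ℝ)
    (hU : ∀ k, ∃ W : Matrix (Fin (n k.succ.succ)) (Fin (n k.succ.succ)) ℂ,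
      W ∈ Matrix.unitaryGroup (Fin (n k.succ.succ)) ℂ ∧ U k = (l k : ℂ) • W)
    (A : TensorSpace n) :
    ∑ i, ‖transformedGrad U d A i‖ ^ 2 ≤ (∏ k, l k) ^ 2 * (4 * ‖A‖ ^ 2) := by
  refine (sum_norm_sq_tensorTransform_le U l hU _).trans ?_
  refine mul_le_mul_of_nonneg_left ?_ (sq_nonneg _)
  rw [EuclideanSpace.norm_sq_eq]
  simp only [Complex.norm_real]
  exact sum_norm_sq_modeProd_le d _ (sum_norm_sq_diffMatrix_mulVec_le _) _

theorem convexOn_tensorPenalty_add (l : Fin K → ℝ) {f : ℝ → ℝ} {μ : ℝ} (hμ : 0 ≤ μ)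
    (hf_min : ∀ x, 0 ≤ x → f 0 ≤ f x)
    (hf : ConvexOn ℝ (Set.Ici (0 : ℝ)) fun x => f x + μ / 2 * ‖x‖ ^ 2) :
    ConvexOn ℝ Set.univ fun A : TensorSpace n =>
      tensorPenalty f U l (tensorGrad d fun t => A t) +
        μ / 2 * (1 / (∏ k, l k) ^ 2 * ∑ i, ‖transformedGrad U d A i‖ ^ 2) := by
  have hform : ∀ A : TensorSpace n, tensorPenalty f U l (tensorGrad d fun t => A t) +
        μ / 2 * (1 / (∏ k, l k) ^ 2 * ∑ i, ‖transformedGrad U d A i‖ ^ 2) =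
      1 / (∏ k, l k) ^ 2 * ∑ i : (k : Fin K) → Fin (n k.succ.succ),
        (∑ j ∈ Finset.range (min (n 0) (n 1)),
          f (matrixSingularValue (faceSlice (transformedGrad U d A) i) j) +
          μ / 2 * ∑ a, ∑ b, ‖faceSlice (transformedGrad U d A) i a b‖ ^ 2) := by
    intro A
    rw [Finset.sum_add_distrib, ← Finset.mul_sum,
      sum_faceSlice (fun z : ℂ => ‖z‖ ^ 2) (transformedGrad U d A)]
    simp only [tensorPenalty, transformedGrad]
    ring
  refine ⟨convex_univ, fun A _ B _ a b ha hb hab => ?_⟩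
  simp only [hform, smul_eq_mul]
  rw [mul_left_comm a, mul_left_comm b, ← mul_add, Finset.mul_sum _ _ a, Finset.mul_sum _ _ b,
    ← Finset.sum_add_distrib]
  refine mul_le_mul_of_nonneg_left (Finset.sum_le_sum fun i _ => ?_) (by positivity)
  have h := (convexOn_spectral_sum_add (p := n 0) (q := n 1) hμ hf_min hf).2
    (Set.mem_univ (faceSlice (transformedGrad U d A) i))
    (Set.mem_univ (faceSlice (transformedGrad U d B) i)) ha hb hab
  have hlin : a • faceSlice (transformedGrad U d A) i + b • faceSlice (transformedGrad U d B) i =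
      faceSlice (transformedGrad U d (a • A + b • B)) i := by
    rw [transformedGrad_smul_add_smul]
    rfl
  rw [hlin] at h
  exact h

theorem convexOn_norm_sq_sub_transformedGrad (l : Fin K → ℝ) (hl : ∀ k, 0 < l k)
    (hU : ∀ k, ∃ W : Matrix (Fin (n k.succ.succ)) (Fin (n k.succ.succ)) ℂ,
      W ∈ Matrix.unitaryGroup (Fin (n k.succ.succ)) ℂ ∧ U k = (l k : ℂ) • W) :
    ConvexOn ℝ Set.univ fun A : TensorSpace n =>
      4 * ‖A‖ ^ 2 - 1 / (∏ k, l k) ^ 2 * ∑ i, ‖transformedGrad U d A i‖ ^ 2 := by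
  refine ⟨convex_univ, fun A _ B _ a b ha hb hab => ?_⟩
  have hpos : 0 < (∏ k, l k) ^ 2 := pow_pos (Finset.prod_pos fun k _ => hl k) 2
  obtain rfl : b = 1 - a := by linarith
  -- A quadratic form `Q` has convexity gap exactly `a (1 - a) Q (x - y)`, so nonnegativity of the
  -- form at `A - B` is all that is needed.
  have hconv : ∀ {V : Type} [NormedAddCommGroup V] [InnerProductSpace ℝ V] (x y : V),
      ‖a • x + (1 - a) • y‖ ^ 2 =
        a * ‖x‖ ^ 2 + (1 - a) * ‖y‖ ^ 2 - a * (1 - a) * ‖x - y‖ ^ 2 := by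
    intro V _ _ x y
    rw [norm_add_sq_real, norm_sub_sq_real, norm_smul, norm_smul, mul_pow, mul_pow,
      Real.norm_eq_abs, Real.norm_eq_abs, sq_abs, sq_abs, real_inner_smul_left,
      real_inner_smul_right]
    ring
  have hT : ∑ i, ‖transformedGrad U d (a • A + (1 - a) • B) i‖ ^ 2 =
      a * ∑ i, ‖transformedGrad U d A i‖ ^ 2 + (1 - a) * ∑ i, ‖transformedGrad U d B i‖ ^ 2 -
        a * (1 - a) * ∑ i, ‖transformedGrad U d (A - B) i‖ ^ 2 := by
    have hsub : transformedGrad U d (A - B) = transformedGrad U d A - transformedGrad U d B := by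
      simpa [sub_eq_add_neg] using transformedGrad_smul_add_smul U d 1 (-1) A B
    rw [transformedGrad_smul_add_smul, hsub, Finset.mul_sum, Finset.mul_sum, Finset.mul_sum,
      ← Finset.sum_add_distrib, ← Finset.sum_sub_distrib]
    exact Finset.sum_congr rfl fun i _ =>
      hconv (transformedGrad U d A i) (transformedGrad U d B i)
  have hle := sum_norm_sq_transformedGrad_le U d l hU (A - B)
  have hle' : 1 / (∏ k, l k) ^ 2 * ∑ i, ‖transformedGrad U d (A - B) i‖ ^ 2 ≤
      4 * ‖A - B‖ ^ 2 := by
    rw [one_div, inv_mul_le_iff₀ hpos]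
    exact hle
  have hfin := mul_le_mul_of_nonneg_left hle' (mul_nonneg ha hb)
  simp only [hT, hconv A B, smul_eq_mul]
  linarith

end TransformedGrad

theorem convexOn_finset_sum {ι V : Type*} [AddCommMonoid V] [Module ℝ V] {S : Set V}
    {t : Finset ι} {φ : ι → V → ℝ} (hS : Convex ℝ S) (h : ∀ i ∈ t, ConvexOn ℝ S (φ i)) :
    ConvexOn ℝ S fun x => ∑ i ∈ t, φ i x := by
  classical
  induction t using Finset.induction_on with
  | empty => simpa using convexOn_const 0 hS
  | insert i t hi ih =>
    simp only [Finset.sum_insert hi]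
    exact (h i (Finset.mem_insert_self i t)).add
      (ih fun j hj => h j (Finset.mem_insert_of_mem hj))

theorem lemma1 {K : ℕ} (hK : 1 ≤ K) (n : Fin (K + 2) → ℕ)
    (U : (k : Fin K) → Matrix (Fin (n k.succ.succ)) (Fin (n k.succ.succ)) ℂ) (l : Fin K → ℝ)
    (hl : ∀ k, 0 < l k)
    (hU : ∀ k, ∃ W : Matrix (Fin (n k.succ.succ)) (Fin (n k.succ.succ)) ℂ,
      W ∈ Matrix.unitaryGroup (Fin (n k.succ.succ)) ℂ ∧ U k = (l k : ℂ) • W)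
    (Γ : Finset (Fin (K + 2))) (hΓ : Γ.Nonempty)
    (μ : ℝ) (f : ℝ → ℝ)
    (hf_nonneg : ∀ x, 0 ≤ x → 0 ≤ f x)
    (hf_min : ∀ x, 0 ≤ x → f 0 ≤ f x)
    (hf_weak : WeaklyConvexOn μ (Set.Ici (0 : ℝ)) f)
    (hf_prox : ∀ η : ℝ, 0 < η → ProxNondecreasing η f) :
    WeaklyConvexOn (4 * μ) (Set.univ : Set (TensorSpace n)) (gtctv f U l Γ) ∧
      ConvexOn ℝ (Set.univ : Set (TensorSpace n))
        (fun A => gtctv f U l Γ A + 2 * μ * ‖A‖ ^ 2) := by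
  obtain ⟨hμ, hf⟩ := hf_weak
  have hγ : (Γ.card : ℝ) ≠ 0 := by exact_mod_cast hΓ.card_ne_zero
  have hsum : ConvexOn ℝ Set.univ fun A : TensorSpace n => ∑ d ∈ Γ,
      (tensorPenalty f U l (tensorGrad d fun t => A t) + 2 * μ * ‖A‖ ^ 2) := by
    refine convexOn_finset_sum convex_univ fun d _ => ?_
    -- The factor `μ / 2` cancels the transformed-gradient terms, leaving `(μ / 2) * 4 = 2 * μ` on
    -- `‖A‖ ^ 2`.
    refine ((convexOn_tensorPenalty_add U d l hμ hf_min hf).add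
      ((convexOn_norm_sq_sub_transformedGrad U d l hl hU).smul (div_nonneg hμ zero_le_two))).congr ?_
    intro A _
    simp only [Pi.add_apply, smul_eq_mul]
    ring
  have hmain : ConvexOn ℝ (Set.univ : Set (TensorSpace n))
      fun A => gtctv f U l Γ A + 2 * μ * ‖A‖ ^ 2 := by
    refine (hsum.smul (c := 1 / (Γ.card : ℝ)) (by positivity)).congr fun A _ => ?_
    simp only [gtctv, Finset.sum_add_distrib, Finset.sum_const, nsmul_eq_mul, smul_eq_mul]
    field_simp
  refine ⟨⟨by positivity, ?_⟩, hmain⟩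
  simpa only [show 4 * μ / 2 = 2 * μ by ring] using hmain
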